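/- Let $t_0\in\mathbb R$, $n\ge 0$, and let $\alpha, b_1,\dots,b_n, h_1,\dots,h_n:\mathbb R\to\mathbb R$ be such that $\alpha$, the $b_j$ and the delays $t-h_j(t)$ are Lebesgue measurable and essentially bounded on $[t_0,\infty)$, with $h_j(t)\le t$ for almost every $t\ge t_0$. Write $\|y\|=\operatorname{ess\,sup}_{t\ge t_0}|y(t)|$. Consider the equation $$\dot x(t)+\alpha(t)x(t)+\sum_{j=1}^n b_j(t)\,x(h_j(t))=0. \qquad (*)$$ For $s\ge t_0$ and a bounded Borel measurable $\psi:(-\infty,s]\to\mathbb R$, a solution of $(*)$ with initial point $s$ and initial function $\psi$ is a function $x:\mathbb R\to\mathbb R$ that equals $\psi$ on $(-\infty,s]$, is locally absolutely continuous on $[s,\infty)$, and satisfies $(*)$ for almost every $t\ge s$. Assume that there is a constant $a_0>0$ with $\alpha(t)\ge a_0$ for almost every $t\ge t_0$, and that either a) $\displaystyle\sum_{j=1}^n\left\|\frac{b_j}{\alpha}\right\|<1$, or b) there are $t_1>t_0$ and $\gamma\in(0,1)$ such that $\displaystyle\sum_{j=1}^n|b_j(t)|\le\gamma\,\alpha(t)$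 for almost every $t\ge t_1$. Then $(*)$ is uniformly exponentially stable: there are constants $M>0$ and $\nu>0$ such that for every $s\ge t_0$, every bounded Borel measurable $\psi:(-\infty,s]\to\mathbb R$ and every solution $x$ of $(*)$ with initial point $s$ and initial function $\psi$, $$|x(t)|\le M e^{-\nu(t-s)}\sup_{u\le s}|\psi(u)|\qquad\text{for all } t\ge s.$$ -/

import Mathlib

open MeasureTheory Set

/-- Lebesgue measure on the half-line `[t₀, ∞)`, the reference measure of `L∞[t₀, ∞)`. -/
noncomputable abbrev halfLine (t₀ : ℝ) : Measure ℝ := volume.restrict (Ici t₀)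

/-- The essential supremum norm `‖y‖ = ess sup_{t ≥ t₀} |y t|`, with values in `[0, ∞]`. -/
noncomputable def essNorm (t₀ : ℝ) (y : ℝ → ℝ) : ENNReal := eLpNorm y ⊤ (halfLine t₀)

/-- The standing assumptions on the parameters of
`x'(t) + α(t) x(t) + ∑ j, b j t * x (h j t) = 0`, `t ≥ t₀`:
the coefficients and the delays `t - h j t ≥ 0` are Lebesgue measurable and essentially bounded
on `[t₀, ∞)`. -/
structure DelayParameters {n : ℕ} (t₀ : ℝ) (α : ℝ → ℝ) (b h : Fin n → ℝ → ℝ) : Prop where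
  memLp_α : MemLp α ⊤ (halfLine t₀)
  memLp_b : ∀ j, MemLp (b j) ⊤ (halfLine t₀)
  memLp_delay : ∀ j, MemLp (fun t => t - h j t) ⊤ (halfLine t₀)
  delay_nonneg : ∀ j, ∀ᵐ t ∂(halfLine t₀), h j t ≤ t

/-- `x` solves `x'(t) + α(t) x(t) + ∑ j, b j t * x (h j t) = 0` for `t ≥ s` with
`x = ψ` on `(-∞, s]`: it is locally absolutely continuous on `[s, ∞)`, and it satisfies the
equation at almost every `t ≥ s`. -/
structure IsDelaySolution {n : ℕ} (α : ℝ → ℝ) (b h : Fin n → ℝ → ℝ) (s : ℝ)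
    (ψ : Iic s → ℝ) (x : ℝ → ℝ) : Prop where
  initial : ∀ u : Iic s, x u = ψ u
  absCont : ∀ T, s ≤ T → AbsolutelyContinuousOnInterval x s T
  equation : ∀ᵐ t ∂(halfLine s),
    HasDerivAt x (-(α t * x t + ∑ j, b j t * x (h j t))) t

/-- Uniform exponential stability: one pair of constants `M, ν > 0` serves all initial points
`s ≥ t₀`, all bounded Borel measurable initial functions `ψ` on `(-∞, s]` and all solutions. -/
def UniformlyExponentiallyStable {n : ℕ} (t₀ : ℝ) (α : ℝ → ℝ) (b h : Fin n → ℝ → ℝ) : Prop :=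
  ∃ M > 0, ∃ ν > 0, ∀ s ≥ t₀, ∀ ψ : Iic s → ℝ, Measurable ψ →
    BddAbove (range fun u => |ψ u|) →
    ∀ x : ℝ → ℝ, IsDelaySolution α b h s ψ x →
      ∀ t ≥ s, |x t| ≤ M * Real.exp (-ν * (t - s)) * ⨆ u, |ψ u|

/-!
Both smallness conditions yield one estimate: from some time `t₁` on, `∑ |b j| ≤ γ α` with `γ < 1`.
Stability follows by comparison with explicit barriers (`abs_le_barrier`): a positive function `φ`
which equals `exp (μ (t - s))` for `t ≥ s` and satisfies
`∑ |b j t| φ (h j t) ≤ (α t + μ) φ t` dominates every solution that it dominates on `(-∞, s]`.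
Indeed, if `|x| / φ` attained a maximum `m` over `[s, T]` at `τ`, with `m` above its bound on
the initial interval, then `u = m ∓ x / φ` would satisfy `u ≥ 0`, `u s > 0` and `u' ≥ -L u`,
so `u τ > 0` by Grönwall (`lt_mul_exp_of_deriv_le`), against the choice of `τ`.

Up to `t₁` the barrier `exp (C (t - s)⁺)`, with `C` a bound of `∑ |b j|`, controls the growth over
a time at most `t₁ - t₀`. From `max s t₁` on, the barrier is `exp (-ν (t - max s t₁))`: since the
delays are bounded by some `H` and `α ≥ a₀ > 0`, the required inequality
`γ α exp (ν H) ≤ α - ν` holds for small `ν > 0`.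
-/

/-! ### Comparison for absolutely continuous functions -/

/-- An absolutely continuous function with almost everywhere nonnegative derivative does not
decrease over the interval. -/
lemma AbsolutelyContinuousOnInterval.le_of_ae_deriv_nonneg {f : ℝ → ℝ} {a c : ℝ} (hac : a ≤ c)
    (hf : AbsolutelyContinuousOnInterval f a c)
    (hd : ∀ᵐ t ∂volume, t ∈ Icc a c → 0 ≤ deriv f t) : f a ≤ f c := by
  have h0 : 0 ≤ ∫ t in a..c, deriv f t := by
    apply intervalIntegral.integral_nonneg_of_ae_restrict hac
    exact (ae_restrict_iff' measurableSet_Icc).2 hd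
  rw [hf.integral_deriv_eq_sub] at h0
  linarith

/-- Grönwall's inequality for the gap `m - x t * exp (-μ * (t - s))`, which decays at most at the
exponential rate `L`: starting positive, it stays positive. -/
lemma lt_mul_exp_of_deriv_le {x d α : ℝ → ℝ} {s τ μ L m : ℝ} (hsτ : s ≤ τ)
    (hac : AbsolutelyContinuousOnInterval x s τ)
    (hx : ∀ t ∈ Icc s τ, x t ≤ m * Real.exp (μ * (t - s))) (hxs : x s < m)
    (hd : ∀ᵐ t ∂volume, t ∈ Icc s τ → HasDerivAt x (d t) t ∧
      d t ≤ -(α t * x t) + (α t + μ) * (m * Real.exp (μ * (t - s))))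
    (hL : ∀ᵐ t ∂volume, t ∈ Icc s τ → α t + μ ≤ L) :
    x τ < m * Real.exp (μ * (τ - s)) := by
  have hE : ∀ c : ℝ, AbsolutelyContinuousOnInterval (fun t => Real.exp (c * (t - s))) s τ :=
    fun c => ContDiffOn.absolutelyContinuousOnInterval (by fun_prop)
  have hm : AbsolutelyContinuousOnInterval (fun _ => m) s τ :=
    ContDiffOn.absolutelyContinuousOnInterval (by fun_prop)
  have hF := AbsolutelyContinuousOnInterval.mul (hm.sub (hac.mul (hE (-μ)))) (hE L)
  have key := hF.le_of_ae_deriv_nonneg hsτ (by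
    filter_upwards [hd, hL] with t htd htL ht
    obtain ⟨h1, h2⟩ := htd ht
    have hexp : ∀ c : ℝ, HasDerivAt (fun t => Real.exp (c * (t - s)))
        (Real.exp (c * (t - s)) * (c * 1)) t :=
      fun c => (((hasDerivAt_id t).sub_const s).const_mul c).exp
    have h3 := ((hasDerivAt_const t m).sub (h1.mul (hexp (-μ)))).mul (hexp L)
    rw [h3.deriv]
    have hpm : Real.exp (μ * (t - s)) * Real.exp (-μ * (t - s)) = 1 := by
      rw [← Real.exp_add]; simp
    have hp := Real.exp_pos (-μ * (t - s))
    have hpL := Real.exp_pos (L * (t - s))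
    have hxt := hx t ht
    have hLt := htL ht
    simp only [Pi.sub_apply, Pi.mul_apply]
    generalize Real.exp (μ * (t - s)) = P at *
    generalize Real.exp (-μ * (t - s)) = Q at *
    generalize Real.exp (L * (t - s)) = R at *
    have e1 : d t * Q ≤ -(α t * (x t * Q)) + (α t + μ) * m := by
      calc d t * Q ≤ (-(α t * x t) + (α t + μ) * (m * P)) * Q := by gcongr
        _ = -(α t * (x t * Q)) + (α t + μ) * m * (P * Q) := by ring
        _ = _ := by rw [hpm]; ring
    have e2 : x t * Q ≤ m := by
      calc x t * Q ≤ m * P * Q := by gcongr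
        _ = m := by rw [mul_assoc, hpm, mul_one]
    have e3 : 0 ≤ (L - (α t + μ)) * (m - x t * Q) := mul_nonneg (by linarith) (by linarith)
    have e4 : 0 ≤ -(d t * Q) + μ * (x t * Q) + L * (m - x t * Q) := by linarith
    calc (0 : ℝ) ≤ R * (-(d t * Q) + μ * (x t * Q) + L * (m - x t * Q)) := by positivity
      _ = _ := by ring)
  have hpos : 0 < (m - x τ * Real.exp (-μ * (τ - s))) * Real.exp (L * (τ - s)) := by
    simp at key
    simp
    linarith
  have h1 := pos_of_mul_pos_left hpos (Real.exp_pos _).le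
  have hp := Real.exp_pos (μ * (τ - s))
  have h2 : 0 < (m - x τ * Real.exp (-μ * (τ - s))) * Real.exp (μ * (τ - s)) := mul_pos h1 hp
  have hpm : Real.exp (-μ * (τ - s)) * Real.exp (μ * (τ - s)) = 1 := by
    rw [← Real.exp_add]; simp
  rw [sub_mul, mul_assoc, hpm] at h2
  linarith

/-! ### Barriers for the delay equation -/

/-- Comparison principle: a positive function `φ` with `φ t = exp (μ * (t - s))` for `t ≥ s` which
is a supersolution of the equation with the `b j` replaced by `-|b j|` bounds every solution that it bounds
on `(-∞, s]`, up to the same factor `N`. -/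
lemma abs_le_barrier {n : ℕ} {α : ℝ → ℝ} {b h : Fin n → ℝ → ℝ} {s μ L N : ℝ} {x φ : ℝ → ℝ}
    (hφ0 : ∀ u, 0 < φ u) (hφ : ∀ t, s ≤ t → φ t = Real.exp (μ * (t - s))) (hN : 0 ≤ N)
    (hx0 : ∀ u ≤ s, |x u| ≤ N * φ u)
    (hac : ∀ T, s ≤ T → AbsolutelyContinuousOnInterval x s T)
    (heq : ∀ᵐ t ∂(halfLine s), HasDerivAt x (-(α t * x t + ∑ j, b j t * x (h j t))) t)
    (hL : ∀ᵐ t ∂(halfLine s), α t + μ ≤ L)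
    (hh : ∀ᵐ t ∂(halfLine s), ∀ j, h j t ≤ t)
    (hb : ∀ᵐ t ∂(halfLine s), ∑ j, |b j t| * φ (h j t) ≤ (α t + μ) * φ t) :
    ∀ t ≥ s, |x t| ≤ N * φ t := by
  intro T hT
  have hcont : ContinuousOn (fun t => |x t| * Real.exp (-μ * (t - s))) (Icc s T) := by
    have := (hac T hT).continuousOn
    rw [uIcc_of_le hT] at this
    fun_prop
  obtain ⟨τ, ⟨hτs, hτT⟩, hτ⟩ := isCompact_Icc.exists_isMaxOn (nonempty_Icc.2 hT) hcont
  set m := |x τ| * Real.exp (-μ * (τ - s)) with hm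
  have hpm : ∀ t, Real.exp (-μ * (t - s)) * Real.exp (μ * (t - s)) = 1 := fun t => by
    rw [← Real.exp_add]; simp
  have hle : ∀ t ∈ Icc s T, |x t| ≤ m * φ t := by
    intro t ht
    have h1 : |x t| * Real.exp (-μ * (t - s)) ≤ m := hτ ht
    have h2 := mul_le_mul_of_nonneg_right h1 (Real.exp_pos (μ * (t - s))).le
    rwa [mul_assoc, hpm, mul_one, ← hφ t ht.1] at h2
  by_cases hmN : m ≤ N
  · exact (hle T ⟨hT, le_rfl⟩).trans (mul_le_mul_of_nonneg_right hmN (hφ0 T).le)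
  exfalso
  push Not at hmN
  have hm0 : 0 ≤ m := hN.trans hmN.le
  have hxτ : |x τ| = m * Real.exp (μ * (τ - s)) := by
    rw [hm, mul_assoc, hpm, mul_one]
  have hall : ∀ u ≤ T, |x u| ≤ m * φ u := by
    intro u hu
    rcases le_total u s with hus | hus
    · exact (hx0 u hus).trans (mul_le_mul_of_nonneg_right hmN.le (hφ0 u).le)
    · exact hle u ⟨hus, hu⟩
  have hxs : |x s| < m := by
    have := hx0 s le_rfl
    rw [hφ s le_rfl] at this
    simp at this
    linarith
  have hsum : ∀ᵐ t ∂volume, t ∈ Icc s τ →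
      |∑ j, b j t * x (h j t)| ≤ (α t + μ) * (m * Real.exp (μ * (t - s))) := by
    filter_upwards [(ae_restrict_iff' measurableSet_Ici).1 hh,
      (ae_restrict_iff' measurableSet_Ici).1 hb] with t h1 h2 ht
    have h1 := h1 ht.1
    have h2 := h2 ht.1
    calc |∑ j, b j t * x (h j t)| ≤ ∑ j, |b j t * x (h j t)| := Finset.abs_sum_le_sum_abs _ _
      _ ≤ ∑ j, m * (|b j t| * φ (h j t)) := by
        refine Finset.sum_le_sum fun j _ => ?_
        rw [abs_mul]
        have := hall (h j t) ((h1 j).trans (ht.2.trans hτT))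
        nlinarith [mul_le_mul_of_nonneg_left this (abs_nonneg (b j t))]
      _ = m * ∑ j, |b j t| * φ (h j t) := by rw [Finset.mul_sum]
      _ ≤ m * ((α t + μ) * φ t) := by gcongr
      _ = _ := by rw [hφ t ht.1]; ring
  have hL' : ∀ᵐ t ∂volume, t ∈ Icc s τ → α t + μ ≤ L := by
    filter_upwards [(ae_restrict_iff' measurableSet_Ici).1 hL] with t h1 ht using h1 ht.1
  have heq' := (ae_restrict_iff' measurableSet_Ici).1 heq
  have hbd : ∀ t ∈ Icc s τ, |x t| ≤ m * Real.exp (μ * (t - s)) := fun t ht => by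
    rw [← hφ t ht.1]; exact hall t (ht.2.trans hτT)
  have hacτ := hac τ hτs
  -- The equation is linear, so a negative extremum of `x` is a positive one of `-x`.
  rcases abs_cases (x τ) with ⟨hc, -⟩ | ⟨hc, -⟩
  · have := lt_mul_exp_of_deriv_le hτs hacτ (fun t ht => (le_abs_self _).trans (hbd t ht))
      ((le_abs_self _).trans_lt hxs)
      (d := fun t => -(α t * x t + ∑ j, b j t * x (h j t))) (α := α) (by
        filter_upwards [hsum, heq'] with t h1 h2 ht
        refine ⟨h2 ht.1, ?_⟩
        linarith [neg_abs_le (∑ j, b j t * x (h j t)), h1 ht]) hL'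
    linarith
  · have := lt_mul_exp_of_deriv_le (x := -x) hτs hacτ.neg
      (fun t ht => (neg_le_abs _).trans (hbd t ht)) ((neg_le_abs _).trans_lt hxs)
      (d := fun t => -(-(α t * x t + ∑ j, b j t * x (h j t)))) (α := α) (by
        filter_upwards [hsum, heq'] with t h1 h2 ht
        refine ⟨(h2 ht.1).neg, ?_⟩
        simp only [Pi.neg_apply]
        linarith [le_abs_self (∑ j, b j t * x (h j t)), h1 ht]) hL'
    simp only [Pi.neg_apply] at this
    linarith

/-! ### Essential bounds -/

lemma halfLine_mono {s t : ℝ} (hst : s ≤ t) {p : ℝ → Prop} (hp : ∀ᵐ u ∂(halfLine s), p u) :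
    ∀ᵐ u ∂(halfLine t), p u :=
  ae_restrict_of_ae_restrict_of_subset (Ici_subset_Ici.2 hst) hp

lemma ae_abs_le_essNorm_toReal {t₀ : ℝ} {y : ℝ → ℝ} (hy : essNorm t₀ y ≠ ⊤) :
    ∀ᵐ t ∂(halfLine t₀), |y t| ≤ (essNorm t₀ y).toReal := by
  filter_upwards [enorm_ae_le_eLpNormEssSup y (halfLine t₀)] with t ht
  rw [← eLpNorm_exponent_top] at ht
  have := ENNReal.toReal_mono hy ht
  simpa using this

/-- The first smallness condition implies the second one, already from `t₀` on. -/
lemma exists_sum_abs_le_of_sum_essNorm_lt_one {n : ℕ} {t₀ a₀ : ℝ} {α : ℝ → ℝ}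
    {b : Fin n → ℝ → ℝ} (ha₀ : 0 < a₀) (hα : ∀ᵐ t ∂(halfLine t₀), a₀ ≤ α t)
    (hb : ∑ j, essNorm t₀ (fun t => b j t / α t) < 1) :
    ∃ γ : ℝ, 0 < γ ∧ γ < 1 ∧ ∀ᵐ t ∂(halfLine t₀), ∑ j, |b j t| ≤ γ * α t := by
  have hfin : ∀ j, essNorm t₀ (fun t => b j t / α t) ≠ ⊤ := fun j =>
    ENNReal.sum_ne_top.1 (hb.trans ENNReal.one_lt_top).ne j (Finset.mem_univ j)
  have hS : ∑ j, (essNorm t₀ (fun t => b j t / α t)).toReal < 1 := by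
    rw [← ENNReal.toReal_sum fun j _ => hfin j]
    simpa using ENNReal.toReal_strict_mono ENNReal.one_ne_top hb
  refine ⟨max (∑ j, (essNorm t₀ (fun t => b j t / α t)).toReal) (1 / 2),
    lt_max_of_lt_right (by norm_num), max_lt hS (by norm_num), ?_⟩
  filter_upwards [hα, ae_all_iff.2 fun j => ae_abs_le_essNorm_toReal (hfin j)] with t ht hj
  have hαt : 0 < α t := ha₀.trans_le ht
  calc ∑ j, |b j t| ≤ ∑ j, (essNorm t₀ (fun t => b j t / α t)).toReal * α t := by
        refine Finset.sum_le_sum fun j _ => ?_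
        have := hj j
        rwa [abs_div, abs_of_pos hαt, div_le_iff₀ hαt] at this
    _ = (∑ j, (essNorm t₀ (fun t => b j t / α t)).toReal) * α t := by rw [Finset.sum_mul]
    _ ≤ _ := by gcongr; exact le_max_left _ _

/-- The decay rate exists because the left-hand side is continuous in `ν` and equals `γ < 1` at
`ν = 0`. -/
lemma exists_rate {γ a₀ : ℝ} (hγ : γ < 1) (H : ℝ) :
    ∃ ν > 0, γ * Real.exp (ν * H) + ν / a₀ ≤ 1 := by
  have hc : Continuous fun ν : ℝ => γ * Real.exp (ν * H) + ν / a₀ := by fun_prop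
  have h1 : ∀ᶠ ν in nhds (0 : ℝ), γ * Real.exp (ν * H) + ν / a₀ < 1 :=
    hc.continuousAt.eventually_lt continuousAt_const (by simpa using hγ)
  obtain ⟨ν, hν, hν0⟩ := ((h1.filter_mono nhdsWithin_le_nhds).and
    (self_mem_nhdsWithin : Ioi (0 : ℝ) ∈ nhdsWithin 0 (Ioi 0))).exists
  exact ⟨ν, hν0, hν.le⟩

/-! ### Uniform exponential stability -/

/-- Stability when the delayed terms are eventually dominated by the instantaneous one. -/
lemma uniformlyExponentiallyStable_of_sum_abs_le {n : ℕ} {t₀ a₀ t₁ γ : ℝ} {α : ℝ → ℝ}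
    {b h : Fin n → ℝ → ℝ} (hpar : DelayParameters t₀ α b h) (ha₀ : 0 < a₀)
    (hα : ∀ᵐ t ∂(halfLine t₀), a₀ ≤ α t) (ht₁ : t₀ ≤ t₁) (hγ0 : 0 < γ) (hγ1 : γ < 1)
    (hb : ∀ᵐ t ∂(halfLine t₁), ∑ j, |b j t| ≤ γ * α t) :
    UniformlyExponentiallyStable t₀ α b h := by
  obtain ⟨A, hA⟩ : ∃ A, ∀ᵐ t ∂(halfLine t₀), |α t| ≤ A :=
    ⟨_, ae_abs_le_essNorm_toReal hpar.memLp_α.2.ne⟩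
  obtain ⟨C, hC0, hC⟩ : ∃ C, 0 ≤ C ∧ ∀ᵐ t ∂(halfLine t₀), ∑ j, |b j t| ≤ C := by
    refine ⟨∑ j, (essNorm t₀ (b j)).toReal, Finset.sum_nonneg fun _ _ => ENNReal.toReal_nonneg, ?_⟩
    filter_upwards [ae_all_iff.2 fun j => ae_abs_le_essNorm_toReal (hpar.memLp_b j).2.ne] with t ht
    exact Finset.sum_le_sum fun j _ => ht j
  obtain ⟨H, hH⟩ : ∃ H, ∀ᵐ t ∂(halfLine t₀), ∀ j, t - h j t ≤ H := by
    refine ⟨∑ j, (essNorm t₀ (fun t => t - h j t)).toReal, ?_⟩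
    filter_upwards [ae_all_iff.2 fun j => ae_abs_le_essNorm_toReal (hpar.memLp_delay j).2.ne]
      with t ht j
    exact (le_abs_self _).trans <| (ht j).trans <| Finset.single_le_sum
      (f := fun j => (essNorm t₀ (fun t => t - h j t)).toReal)
      (fun _ _ => ENNReal.toReal_nonneg) (Finset.mem_univ j)
  have hdel : ∀ᵐ t ∂(halfLine t₀), ∀ j, h j t ≤ t := ae_all_iff.2 hpar.delay_nonneg
  obtain ⟨ν, hν0, hν⟩ := exists_rate (a₀ := a₀) hγ1 H
  refine ⟨Real.exp ((C + ν) * (t₁ - t₀)), Real.exp_pos _, ν, hν0, ?_⟩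
  intro s hs ψ _ hψ x hx
  set N := ⨆ u, |ψ u| with hNdef
  have hxN : ∀ u ≤ s, |x u| ≤ N := fun u hu => by
    rw [show x u = ψ ⟨u, hu⟩ from hx.initial ⟨u, hu⟩]
    exact le_ciSup hψ ⟨u, hu⟩
  have hN : 0 ≤ N := (abs_nonneg _).trans (hxN s le_rfl)
  -- Growth at rate at most `C`; the barrier is constant before `s`.
  have hgrow : ∀ t ≥ s, |x t| ≤ N * Real.exp (C * max (t - s) 0) := by
    refine abs_le_barrier (μ := C) (L := A + C) (fun u => Real.exp_pos _)
      (fun t ht => by rw [max_eq_left (by linarith)]) hN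
      (fun u hu => by rw [max_eq_right (by linarith)]; simpa using hxN u hu)
      hx.absCont hx.equation ?_ (halfLine_mono hs hdel) ?_
    · filter_upwards [halfLine_mono hs hA] with t ht
      linarith [le_abs_self (α t)]
    · filter_upwards [halfLine_mono hs hC, halfLine_mono hs hdel, halfLine_mono hs hα]
        with t h1 h2 h3
      calc ∑ j, |b j t| * Real.exp (C * max (h j t - s) 0)
          ≤ ∑ j, |b j t| * Real.exp (C * max (t - s) 0) := by
            gcongr with j
            exact h2 j
        _ = (∑ j, |b j t|) * Real.exp (C * max (t - s) 0) := by rw [Finset.sum_mul]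
        _ ≤ _ := by gcongr; linarith
  set r := max s t₁ with hr
  have hsr : s ≤ r := le_max_left _ _
  have h1r : t₁ ≤ r := le_max_right _ _
  have h0r : t₀ ≤ r := hs.trans hsr
  have hrs : r - s ≤ t₁ - t₀ := by
    rcases max_cases s t₁ with ⟨h1, -⟩ | ⟨h1, -⟩ <;> rw [hr, h1] <;> linarith
  set K := N * Real.exp (C * (t₁ - t₀)) with hK
  have hK0 : 0 ≤ K := by positivity
  have hxK : ∀ u ≤ r, |x u| ≤ K := by
    intro u hu
    rcases le_total u s with hus | hus
    · refine (hxN u hus).trans (le_mul_of_one_le_right hN (Real.one_le_exp ?_))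
      exact mul_nonneg hC0 (by linarith)
    · refine (hgrow u hus).trans ?_
      rw [max_eq_left (by linarith), hK]
      gcongr N * Real.exp (C * ?_)
      linarith
  -- Decay from `r` on; the barrier is at least `1` before `r`.
  have hdecay : ∀ t ≥ r, |x t| ≤ K * Real.exp (-ν * (t - r)) := by
    refine abs_le_barrier (μ := -ν) (L := A) (fun u => Real.exp_pos _) (fun t _ => rfl) hK0
      (fun u hu => (hxK u hu).trans (le_mul_of_one_le_right hK0 (Real.one_le_exp ?_)))
      (fun T hT => (hx.absCont T (hsr.trans hT)).mono ?_) (halfLine_mono hsr hx.equation) ?_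
      (halfLine_mono h0r hdel) ?_
    · nlinarith
    · rw [uIcc_of_le hT, uIcc_of_le (hsr.trans hT)]
      exact Icc_subset_Icc_left hsr
    · filter_upwards [halfLine_mono h0r hA] with t ht
      linarith [le_abs_self (α t)]
    · filter_upwards [halfLine_mono h1r hb, halfLine_mono h0r hH, halfLine_mono h0r hα]
        with t h1 h2 h3
      have hαt : 0 < α t := ha₀.trans_le h3
      have hνα : ν ≤ ν / a₀ * α t := by
        rw [div_mul_eq_mul_div, le_div_iff₀ ha₀]
        gcongr
      calc ∑ j, |b j t| * Real.exp (-ν * (h j t - r))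
          ≤ ∑ j, |b j t| * (Real.exp (ν * H) * Real.exp (-ν * (t - r))) := by
            refine Finset.sum_le_sum fun j _ => ?_
            rw [← Real.exp_add]
            gcongr
            nlinarith [h2 j]
        _ = (∑ j, |b j t|) * Real.exp (ν * H) * Real.exp (-ν * (t - r)) := by
            rw [Finset.sum_mul, Finset.sum_mul]
            exact Finset.sum_congr rfl fun j _ => by ring
        _ ≤ (γ * α t) * Real.exp (ν * H) * Real.exp (-ν * (t - r)) := by gcongr
        _ ≤ _ := by
            gcongr
            nlinarith [mul_le_mul_of_nonneg_right hν hαt.le]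
  intro t ht
  have hfinal : K * Real.exp (-ν * (t - s) + ν * (t₁ - t₀)) =
      Real.exp ((C + ν) * (t₁ - t₀)) * Real.exp (-ν * (t - s)) * N := by
    rw [hK, add_mul C, Real.exp_add, Real.exp_add]; ring
  rw [← hfinal]
  rcases le_total r t with hrt | hrt
  · refine (hdecay t hrt).trans ?_
    gcongr
    nlinarith
  · refine (hxK t hrt).trans (le_mul_of_one_le_right hK0 (Real.one_le_exp ?_))
    nlinarith

theorem corollary4p4 (n : ℕ) (t₀ : ℝ) (α : ℝ → ℝ) (b h : Fin n → ℝ → ℝ)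
    (hpar : DelayParameters t₀ α b h)
    (a₀ : ℝ) (ha₀ : 0 < a₀) (hα : ∀ᵐ t ∂(halfLine t₀), a₀ ≤ α t)
    (hab : (∑ j, essNorm t₀ (fun t => b j t / α t) < 1) ∨
      (∃ t₁ > t₀, ∃ γ : ℝ, 0 < γ ∧ γ < 1 ∧
        ∀ᵐ t ∂(halfLine t₁), ∑ j, |b j t| ≤ γ * α t)) :
    UniformlyExponentiallyStable t₀ α b h := by
  rcases hab with hsum | ⟨t₁, ht₁, γ, hγ0, hγ1, hb⟩
  · obtain ⟨γ, hγ0, hγ1, hb⟩ := exists_sum_abs_le_of_sum_essNorm_lt_one ha₀ hα hsum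
    exact uniformlyExponentiallyStable_of_sum_abs_le hpar ha₀ hα le_rfl hγ0 hγ1 hb
  · exact uniformlyExponentiallyStable_of_sum_abs_le hpar ha₀ hα ht₁.le hγ0 hγ1 hb
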